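/- Let $(T,m)$ be a Noetherian local ring, let $R=T[x_1,\dots,x_n]$ be the polynomial ring in $n\ge 0$ variables over $T$, graded by $\deg T=0$ and $\deg x_i=1$, and put $I=(x_1,\dots,x_n)R$ and $P=mR+I$. Let $f\in R$ be a homogeneous polynomial ($f=0$ is allowed), let $C_f\subseteq T$ be the ideal of $T$ generated by the nonzero coefficients of $f$, and let $H^n_I(R/fR)$ denote the $n$-th local cohomology module of $R/fR$ with support in $I$. Then $$\operatorname{Supp}_R H^n_I(R/fR)=\{Q\in\operatorname{Spec}R \mid Q\supseteq I+C_fR\}.$$ Moreover, if $C_f$ is $m$-primary (that is, $C_f$ is a primary ideal with radical $m$), then $P$ is a prime ideal of $R$ and $$\operatorname{Supp}_R H^n_I(R/fR)=\{P\}.$$ -/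

import Mathlib

universe u

noncomputable section

open MvPolynomial

/-- The ideal `C_f` of `T` generated by the (nonzero) coefficients of a polynomial `f`. -/
def coeffIdeal {T : Type*} [CommRing T] {n : ℕ} (f : MvPolynomial (Fin n) T) : Ideal T :=
  Ideal.span (f.coeffs : Set T)

/-- The homogeneous maximal ideal `P = m + I` of `T[x_1, …, x_n]`, for `(T, m)` local. -/
def homogeneousMaximalIdeal (T : Type*) [CommRing T] [IsLocalRing T] (n : ℕ) :
    Ideal (MvPolynomial (Fin n) T) :=
  (IsLocalRing.maximalIdeal T).map C ⊔ idealOfVars (Fin n) T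

/-- `J` is `m`-primary: it is a primary ideal whose radical is `m`. -/
def IsPrimaryTo {T : Type*} [CommRing T] (J m : Ideal T) : Prop :=
  J.IsPrimary ∧ J.radical = m

/-- The local cohomology module `H^n_I(R/fR)` over `R = T[x_1, …, x_n]`,
with `I = (x_1, …, x_n)`. -/
abbrev topLocalCohomology {T : Type u} [CommRing T] {n : ℕ} (f : MvPolynomial (Fin n) T) :
    ModuleCat.{u} (MvPolynomial (Fin n) T) :=
  (localCohomology (idealOfVars (Fin n) T) n).obj
    (ModuleCat.of (MvPolynomial (Fin n) T) (MvPolynomial (Fin n) T ⧸ Ideal.span {f}))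

end

-- Write $E=H^n_I(R)$. The quotients $R/(x_1^t,\dots,x_n^t)$ have projective dimension at most $n$
-- and are cofinal with the $R/I^t$. Hence classes in $\mathrm{Ext}^{n+1}(R/I^t,-)$ die in the limit
-- and $H^n_I$ is right exact, so $H^n_I(R/fR)$ is $E/fE$. Moreover $E$ is the module of inverse
-- polynomials, free over $T$ on the monomials with all exponents negative.
--
-- Three facts about $E/fE$ give the support. It is $I$-torsion, so only primes containing $I$
-- occur. If a prime $Q$ does not contain $C_f$, put $q=Q\cap T$; multiplication by $f$ into inverse
-- monomials of a fixed degree has a square submatrix that is triangular modulo $q$ with a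
-- coefficient outside $q$ on the diagonal. Its determinant $s\notin q$ carries those monomials into
-- $fE$, so $(E/fE)_Q=0$ (`exists_C_smul_inverseMonomial`). Finally, any $s$ annihilating the class
-- of $(x_1\cdots x_n)^{-1}$ has constant term in $C_f$ (`constantCoeff_mem_coeffIdeal`), hence lies
-- in every prime containing $I+C_f$.
--
-- The isomorphism with $E/fE$ is never constructed: the argument runs on classes in
-- $\mathrm{Ext}^n(R/I^t,-)$ at finite stages $t$, enlarging $t$ when needed. Local cohomology is
-- defined by the left derived `_root_.Ext`, whereas Yoneda products and long exact sequences are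
-- those of `Abelian.Ext`; a comparison natural in the first argument (`leftDerivedExtEquiv_map`)
-- links the two.

universe v w t

/-! ### Comparison of the two constructions of Ext -/

noncomputable section
open CategoryTheory Abelian Opposite Limits

namespace CategoryTheory.ProjectiveResolution

section
variable {C : Type u} [Category.{v} C] [Abelian C] {X Y : C} (P : ProjectiveResolution X)
  (R : Type t) [CommRing R] [Linear R C]

/-- The module of cocycles of degree `n`, from a projective resolution to an object. -/
def cocycles (Y : C) (n : ℕ) : Submodule R (P.complex.X n ⟶ Y) :=
  LinearMap.ker (Linear.leftComp R Y (P.complex.d (n + 1) n))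

end

section
variable {C : Type u} [Category.{v} C] [Abelian C] [HasExt.{w} C]
  {X Y : C} (P : ProjectiveResolution X)

/-- The resolution, as a cochain complex, vanishes in degree 1, so there are no nonzero coboundaries
in degree 0. -/
lemma extMk_zero_eq_zero_iff (f : P.complex.X 0 ⟶ Y) (hf : P.complex.d 1 0 ≫ f = 0) :
    P.extMk f 1 rfl hf = 0 ↔ f = 0 := by
  rw [← P.extEquivCohomologyClass.apply_eq_iff_eq, extEquivCohomologyClass_extMk,
    extEquivCohomologyClass_zero, CochainComplex.HomComplex.CohomologyClass.mk_eq_zero_iff,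
    CochainComplex.HomComplex.Cocycle.toSingleMk_mem_coboundaries_iff _ _ _ _ _ 1 (by simp)]
  have h0 : IsZero (P.cochainComplex.X 1) := P.cochainComplex.isZero_of_isStrictlyLE 0 1
  constructor
  · rintro ⟨g, hg⟩
    rw [h0.eq_of_src g 0, comp_zero] at hg
    rw [← cancel_epi (P.cochainComplexXIso (-(0 : ℕ)) 0 rfl).hom, comp_zero]
    exact hg.symm
  · rintro rfl
    exact ⟨0, by simp⟩

variable (R : Type t) [CommRing R] [Linear R C]

lemma smul_extMk {n : ℕ} (r : R) (f : P.complex.X n ⟶ Y) (m : ℕ) (hm : n + 1 = m)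
    (hf : P.complex.d m n ≫ f = 0) :
    r • P.extMk f m hm hf = P.extMk (r • f) m hm (by simp [hf]) := by
  rw [Ext.smul_eq_comp_mk₀, extMk_comp_mk₀]
  congr 1
  simp

/-- The class in `Ext` of a cocycle, as a linear map. -/
def extClassMap (Y : C) (n : ℕ) : P.cocycles R Y n →ₗ[R] Abelian.Ext.{w} X Y n where
  toFun f := P.extMk f.1 (n + 1) rfl f.2
  map_add' f g := (P.add_extMk f.1 g.1 (n + 1) rfl f.2 g.2).symm
  map_smul' r f := (P.smul_extMk R r f.1 (n + 1) rfl f.2).symm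

lemma extClassMap_surjective (Y : C) (n : ℕ) :
    Function.Surjective (P.extClassMap R Y n) := fun α => by
  obtain ⟨f, hf, rfl⟩ := P.extMk_surjective α (n + 1) rfl
  exact ⟨⟨f, hf⟩, rfl⟩

/-- Phrased with `next n` to match `homologyClassMap_eq_zero_iff`. For `n = 0` one has `next 0 = 0`
with zero differential, so the condition correctly reads `f = 0`. -/
lemma extClassMap_eq_zero_iff {n : ℕ} (f : P.cocycles R Y n) :
    P.extClassMap R Y n f = 0 ↔
      ∃ g : P.complex.X ((ComplexShape.down ℕ).next n) ⟶ Y, P.complex.d n _ ≫ g = f.1 := by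
  obtain ⟨f, hf⟩ := f
  cases n with
  | zero =>
    refine (P.extMk_zero_eq_zero_iff f hf).trans ?_
    simp [eq_comm]
  | succ n =>
    rw [ChainComplex.next_nat_succ]
    exact P.extMk_eq_zero_iff f _ rfl hf n rfl

end

section
variable {R : Type t} [CommRing R] {C : Type u} [Category.{v} C] [Abelian C] [Linear R C]
  {X : C} (P : ProjectiveResolution X)

/-- The complex in the opposite of `ModuleCat R` computing the left derived functors of
`Hom(-, Y)`. -/
abbrev homComplex (R : Type t) [CommRing R] [Linear R C] (Y : C) :
    ChainComplex (ModuleCat.{v} R)ᵒᵖ ℕ :=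
  (((linearYoneda R C).obj Y).rightOp.mapHomologicalComplex _).obj P.complex

/-- The comparison from opcycles to cocycles. -/
def opcyclesToCocycles (Y : C) (n : ℕ) :
    (P.homComplex R Y).opcycles n ⟶ op (ModuleCat.of R (P.cocycles R Y n)) :=
  (P.homComplex R Y).descOpcycles (j := n + 1)
    (Quiver.Hom.op (ModuleCat.ofHom (P.cocycles R Y n).subtype)) (by simp) (by
      apply Quiver.Hom.unop_inj
      ext f
      exact f.2)

/-- The homology class of a cocycle. -/
def homologyClassMap (Y : C) (n : ℕ) :
    P.cocycles R Y n →ₗ[R] ((P.homComplex R Y).homology n).unop :=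
  ((P.homComplex R Y).homologyι n ≫ P.opcyclesToCocycles Y n).unop.hom

lemma opcyclesToCocycles_apply (Y : C) (n : ℕ) (z : P.cocycles R Y n) :
    ((P.homComplex R Y).pOpcycles n).unop.hom ((P.opcyclesToCocycles Y n).unop.hom z) = z.1 := by
  have := (P.homComplex R Y).p_descOpcycles (j := n + 1)
    (Quiver.Hom.op (ModuleCat.ofHom (P.cocycles R Y n).subtype)) (by simp) (by
      apply Quiver.Hom.unop_inj
      ext f
      exact f.2)
  have := congr_arg (fun φ => φ.unop.hom z) this
  exact this

lemma pOpcycles_injective (Y : C) (n : ℕ) :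
    Function.Injective ((P.homComplex R Y).pOpcycles n).unop.hom :=
  (ModuleCat.mono_iff_injective _).1 inferInstance

lemma opcyclesToCocycles_surjective (Y : C) (n : ℕ) :
    Function.Surjective (P.opcyclesToCocycles (R := R) Y n).unop.hom := fun o => by
  refine ⟨⟨((P.homComplex R Y).pOpcycles n).unop.hom o, ?_⟩, ?_⟩
  · have := (P.homComplex R Y).d_pOpcycles (n + 1) n
    exact congr_arg (fun φ => φ.unop.hom o) this
  · apply P.pOpcycles_injective
    rw [opcyclesToCocycles_apply]

lemma homologyClassMap_surjective (Y : C) (n : ℕ) :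
    Function.Surjective (P.homologyClassMap (R := R) Y n) := by
  have h : Function.Surjective ((P.homComplex R Y).homologyι n).unop.hom :=
    (ModuleCat.epi_iff_surjective _).1 inferInstance
  exact h.comp (P.opcyclesToCocycles_surjective Y n)

/-- Passing from the opposite category to modules turns opcycles into cocycles and the kernel
property of `homologyι` into exactness at the cocycles, with the coboundaries as image. -/
lemma homologyClassMap_eq_zero_iff {Y : C} {n : ℕ} (f : P.cocycles R Y n) :
    P.homologyClassMap Y n f = 0 ↔
      ∃ g : P.complex.X ((ComplexShape.down ℕ).next n) ⟶ Y, P.complex.d n _ ≫ g = f.1 := by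
  set K := P.homComplex R Y
  have hex : (ShortComplex.mk _ _ (K.homologyι_comp_fromOpcycles n
      ((ComplexShape.down ℕ).next n))).unop.Exact :=
    (ShortComplex.exact_of_f_is_kernel _ (K.homologyIsKernel n _ rfl)).unop
  rw [ShortComplex.moduleCat_exact_iff] at hex
  have hp : ∀ g, (K.pOpcycles n).unop.hom ((K.fromOpcycles n
      ((ComplexShape.down ℕ).next n)).unop.hom g) =
      P.complex.d n ((ComplexShape.down ℕ).next n) ≫ g := fun g =>
    congr_arg (fun φ => φ.unop.hom g) (K.p_fromOpcycles n ((ComplexShape.down ℕ).next n))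
  constructor
  · intro h
    obtain ⟨g, hg⟩ := hex _ h
    refine ⟨g, ?_⟩
    exact (hp g).symm.trans ((congr_arg (K.pOpcycles n).unop.hom hg).trans
      (P.opcyclesToCocycles_apply Y n f))
  · rintro ⟨g, hg⟩
    have : (P.opcyclesToCocycles Y n).unop.hom f = (K.fromOpcycles n _).unop.hom g := by
      apply P.pOpcycles_injective
      rw [P.opcyclesToCocycles_apply, ← hg]
      exact (hp g).symm
    change (K.homologyι n).unop.hom ((P.opcyclesToCocycles Y n).unop.hom f) = 0
    rw [this]
    exact congr_arg (fun φ => φ.unop.hom g) (K.homologyι_comp_fromOpcycles n _)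


lemma homologyClassMap_comp {X' : C} {P' : ProjectiveResolution X'} {g : X' ⟶ X} (φ : Hom P' P g)
    {Y : C} {n : ℕ} (f : P.cocycles R Y n) (f' : P'.cocycles R Y n)
    (hf : f'.1 = φ.hom.f n ≫ f.1) :
    (HomologicalComplex.homologyMap ((((linearYoneda R C).obj Y).rightOp.mapHomologicalComplex
      (ComplexShape.down ℕ)).map φ.hom) n).unop.hom (P.homologyClassMap Y n f) =
    P'.homologyClassMap Y n f' := by
  set ψ : P'.homComplex R Y ⟶ P.homComplex R Y :=
    (((linearYoneda R C).obj Y).rightOp.mapHomologicalComplex (ComplexShape.down ℕ)).map φ.hom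
  have h1 : (HomologicalComplex.opcyclesMap ψ n).unop.hom ((P.opcyclesToCocycles Y n).unop.hom f) =
      (P'.opcyclesToCocycles Y n).unop.hom f' := by
    apply P'.pOpcycles_injective
    rw [opcyclesToCocycles_apply, hf, ← P.opcyclesToCocycles_apply]
    exact congr_arg (fun χ => χ.unop.hom ((P.opcyclesToCocycles Y n).unop.hom f))
      (HomologicalComplex.p_opcyclesMap ψ n)
  have h2 := congr_arg (fun χ => χ.unop.hom ((P.opcyclesToCocycles Y n).unop.hom f))
      (HomologicalComplex.homologyι_naturality ψ n)
  exact h2.trans (congr_arg ((P'.homComplex R Y).homologyι n).unop.hom h1)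

variable [HasExt.{w} C]

/-- The cohomology of `Hom(P, Y)`, for a projective resolution `P` of `X`, is `Ext X Y n`. -/
def homologyEquivExt (Y : C) (n : ℕ) :
    ((P.homComplex R Y).homology n).unop ≃ₗ[R] Abelian.Ext.{w} X Y n :=
  ((P.homologyClassMap Y n).quotKerEquivOfSurjective (P.homologyClassMap_surjective Y n)).symm ≪≫ₗ
    Submodule.quotEquivOfEq _ _ (by
      ext f
      rw [LinearMap.mem_ker, LinearMap.mem_ker, homologyClassMap_eq_zero_iff,
        extClassMap_eq_zero_iff]) ≪≫ₗ
    (P.extClassMap R Y n).quotKerEquivOfSurjective (P.extClassMap_surjective R Y n)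

lemma homologyEquivExt_homologyClassMap {Y : C} {n : ℕ} (f : P.cocycles R Y n) :
    P.homologyEquivExt Y n (P.homologyClassMap Y n f) = P.extClassMap R Y n f := by
  have : ((P.homologyClassMap Y n).quotKerEquivOfSurjective
      (P.homologyClassMap_surjective Y n)).symm (P.homologyClassMap Y n f) =
      Submodule.Quotient.mk f := by
    rw [LinearEquiv.symm_apply_eq]
    rfl
  simp only [homologyEquivExt, LinearEquiv.trans_apply, this]
  rfl

end

end CategoryTheory.ProjectiveResolution

namespace CategoryTheory.Abelian

variable {R : Type t} [CommRing R] {C : Type u} [Category.{v} C] [Abelian C] [Linear R C]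
  [EnoughProjectives C] [HasExt.{w} C]

/-- The left derived `Ext` agrees with the `Ext` defined through the derived category. -/
def leftDerivedExtEquiv (X Y : C) (n : ℕ) :
    (((_root_.Ext R C n).obj (op X)).obj Y) ≃ₗ[R] Abelian.Ext.{w} X Y n :=
  ((projectiveResolution X).isoLeftDerivedObj
    ((linearYoneda R C).obj Y).rightOp n).unop.symm.toLinearEquiv ≪≫ₗ
    (projectiveResolution X).homologyEquivExt Y n

/-- Both sides are computed on cocycles by precomposing with one lift of `g` to the resolutions.
This makes the transition maps of local cohomology Yoneda products. -/
lemma leftDerivedExtEquiv_map {X X' : C} (g : X' ⟶ X) (Y : C) (n : ℕ)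
    (z : ((_root_.Ext R C n).obj (op X)).obj Y) :
    leftDerivedExtEquiv X' Y n ((((_root_.Ext R C n).map g.op).app Y).hom z) =
      (Ext.mk₀ g).comp (leftDerivedExtEquiv X Y n z) (zero_add n) := by
  set P := projectiveResolution X
  set P' := projectiveResolution X'
  set F := ((linearYoneda R C).obj Y).rightOp
  let φ : ProjectiveResolution.Hom P' P g :=
    ⟨ProjectiveResolution.lift g P' P,
      by simpa using ProjectiveResolution.lift_commutes_zero g P' P⟩
  have key : (F.leftDerived n).map g ≫ (P.isoLeftDerivedObj F n).hom =
      (P'.isoLeftDerivedObj F n).hom ≫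
        HomologicalComplex.homologyMap ((F.mapHomologicalComplex _).map φ.hom) n :=
    ProjectiveResolution.isoLeftDerivedObj_hom_naturality g P' P φ.hom
      (ProjectiveResolution.lift_commutes_zero g P' P) F n
  obtain ⟨f, rfl⟩ : ∃ f, z = (P.isoLeftDerivedObj F n).hom.unop.hom (P.homologyClassMap Y n f) := by
    obtain ⟨f, hf⟩ := P.homologyClassMap_surjective (R := R) Y n
      ((P.isoLeftDerivedObj F n).inv.unop.hom z)
    refine ⟨f, ?_⟩
    rw [hf]
    exact (congr_arg (fun χ => χ.unop.hom z) (P.isoLeftDerivedObj F n).hom_inv_id).symm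
  have h1 : ∀ (X₁ : C) (w : (((projectiveResolution X₁).homComplex R Y).homology n).unop),
      leftDerivedExtEquiv X₁ Y n (((projectiveResolution X₁).isoLeftDerivedObj F n).hom.unop.hom w) =
        (projectiveResolution X₁).homologyEquivExt Y n w := fun X₁ w =>
    congr_arg ((projectiveResolution X₁).homologyEquivExt Y n)
      (congr_arg (fun χ => χ.unop.hom w)
        ((projectiveResolution X₁).isoLeftDerivedObj F n).inv_hom_id)
  have h2 := congr_arg (fun χ => χ.unop.hom (P.homologyClassMap Y n f)) key
  let f' : P'.cocycles R Y n := ⟨φ.hom.f n ≫ f.1, by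
    change P'.complex.d (n + 1) n ≫ φ.hom.f n ≫ f.1 = 0
    rw [← φ.hom.comm_assoc, show P.complex.d (n + 1) n ≫ f.1 = 0 from f.2, comp_zero]⟩
  have h3 := P.homologyClassMap_comp φ f f' rfl
  refine (congr_arg (leftDerivedExtEquiv X' Y n) (h2.trans
    (congr_arg (P'.isoLeftDerivedObj F n).hom.unop.hom h3))).trans ?_
  rw [h1, h1, ProjectiveResolution.homologyEquivExt_homologyClassMap,
    ProjectiveResolution.homologyEquivExt_homologyClassMap]
  exact (ProjectiveResolution.mk₀_comp_extMk f.1 (n + 1) rfl f.2 φ).symm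

end CategoryTheory.Abelian
end

/-! ### Local cohomology as a filtered colimit of Ext modules -/

noncomputable section
open CategoryTheory Abelian Opposite Limits

namespace localCohomology

variable {R : Type u} [CommRing R] (J : Ideal R) (M : ModuleCat.{u} R) (n : ℕ)

/-- The quotient of `R` by a power of an ideal, as a module. -/
abbrev powQuotient (t : ℕ) : ModuleCat.{u} R := ModuleCat.of R (R ⧸ J ^ t)

variable {J} in
/-- The projection between quotients by powers of an ideal. -/
abbrev powProj {s t : ℕ} (h : s ≤ t) : powQuotient J t ⟶ powQuotient J s :=
  ModuleCat.ofHom (Submodule.mapQ _ _ LinearMap.id (Ideal.pow_le_pow_right h))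

/-- The structure map to the colimit defining local cohomology. -/
def ofExtDerived (t : ℕ) :
    ((_root_.Ext R (ModuleCat.{u} R) n).obj (op (powQuotient J t))).obj M ⟶
      (localCohomology J n).obj M :=
  have := hasColimitDiagram.{u, 0} (idealPowersDiagram J) n
  (colimit.ι (diagram (idealPowersDiagram J) n) (op (op t))).app M

/-- The structure map from the derived category `Ext` to local cohomology. -/
def ofExt (t : ℕ) :
    Abelian.Ext.{u} (powQuotient J t) M n →ₗ[R] (localCohomology J n).obj M :=
  (ofExtDerived J M n t).hom ∘ₗ (leftDerivedExtEquiv (powQuotient J t) M n).symm.toLinearMap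

lemma ofExtDerived_map {s t : ℕ} (h : s ≤ t) :
    ((_root_.Ext R (ModuleCat.{u} R) n).map (powProj (J := J) h).op).app M ≫
      ofExtDerived J M n t = ofExtDerived J M n s := by
  have := hasColimitDiagram.{u, 0} (idealPowersDiagram J) n
  exact NatTrans.congr_app (colimit.w (diagram (idealPowersDiagram J) n)
    (homOfLE h).op.op) M

lemma ofExt_comp_powProj {s t : ℕ} (h : s ≤ t) (x : Abelian.Ext.{u} (powQuotient J s) M n) :
    ofExt J M n t ((Ext.mk₀ (powProj h)).comp x (zero_add n)) = ofExt J M n s x := by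
  obtain ⟨z, rfl⟩ := (leftDerivedExtEquiv (R := R) (powQuotient J s) M n).surjective x
  rw [← leftDerivedExtEquiv_map (R := R)]
  simp only [ofExt, LinearMap.comp_apply, LinearEquiv.coe_coe, LinearEquiv.symm_apply_apply]
  exact congr_arg (fun χ => χ.hom z) (ofExtDerived_map J M n h)

/-- Local cohomology of a module is a filtered colimit of `Ext` modules. -/
def isColimitApp :
    have := hasColimitDiagram.{u, 0} (idealPowersDiagram J) n
    IsColimit ((forget (ModuleCat.{u} R)).mapCocone (((evaluation _ _).obj M).mapCocone
      (colimit.cocone (diagram (idealPowersDiagram J) n)))) :=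
  have : PreservesFilteredColimitsOfSize.{0, 0} (forget (ModuleCat.{u} R)) :=
    preservesFilteredColimitsOfSize_shrink.{0, u, 0, u} _
  have := hasColimitDiagram.{u, 0} (idealPowersDiagram J) n
  isColimitOfPreserves _ (isColimitOfPreserves ((evaluation _ _).obj M)
    (colimit.isColimit (diagram (idealPowersDiagram J) n)))

lemma exists_ofExt_eq (z : (localCohomology J n).obj M) :
    ∃ (t : ℕ) (x : Abelian.Ext.{u} (powQuotient J t) M n), ofExt J M n t x = z := by
  obtain ⟨t, y, hy⟩ := Types.jointly_surjective _ (isColimitApp J M n) z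
  refine ⟨t.unop.unop, leftDerivedExtEquiv (R := R) (powQuotient J t.unop.unop) M n y, ?_⟩
  exact (congr_arg (ofExtDerived J M n t.unop.unop).hom
    ((leftDerivedExtEquiv (R := R) (powQuotient J t.unop.unop) M n).symm_apply_apply y)).trans hy

lemma exists_comp_powProj_eq_zero {t : ℕ} (x : Abelian.Ext.{u} (powQuotient J t) M n)
    (hx : ofExt J M n t x = 0) :
    ∃ (s : ℕ) (h : t ≤ s), (Ext.mk₀ (powProj (J := J) h)).comp x (zero_add n) = 0 := by
  obtain ⟨z, rfl⟩ := (leftDerivedExtEquiv (R := R) (powQuotient J t) M n).surjective x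
  simp only [ofExt, LinearMap.comp_apply, LinearEquiv.coe_coe, LinearEquiv.symm_apply_apply] at hx
  have h0 : ofExtDerived J M n t z = ofExtDerived J M n t 0 := hx.trans (map_zero _).symm
  obtain ⟨s, f, g, hs⟩ := (Types.FilteredColimit.isColimit_eq_iff _ (isColimitApp J M n)).1 h0
  have hfg : f = g := Subsingleton.elim _ _
  subst hfg
  have hle : t ≤ s.unop.unop := f.unop.unop.le
  refine ⟨s.unop.unop, hle, ?_⟩
  rw [← leftDerivedExtEquiv_map (R := R)]
  have : (((_root_.Ext R (ModuleCat.{u} R) n).map (powProj (J := J) hle).op).app M).hom z = 0 :=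
    hs.trans (map_zero (((_root_.Ext R (ModuleCat.{u} R) n).map
      (powProj (J := J) hle).op).app M).hom)
  rw [this, map_zero]

end localCohomology
end

/-! ### Projective dimension and vanishing of Ext in degree n + 1 -/

noncomputable section
open CategoryTheory Abelian Opposite Limits

namespace Ideal

variable {R : Type u} [CommRing R]

/-- As `a` is a nonzerodivisor on `R ⧸ J`, multiplication by `a` gives a short exact sequence with
two copies of `R ⧸ J` and cokernel `R ⧸ (J ⊔ span {a})`. -/
lemma hasProjectiveDimensionLT_quotient_sup_span_singleton {J : Ideal R} {a : R}
    (ha : ∀ r, a * r ∈ J → r ∈ J) {k : ℕ}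
    (hJ : HasProjectiveDimensionLT (ModuleCat.of R (R ⧸ J)) k) :
    HasProjectiveDimensionLT (ModuleCat.of R (R ⧸ (J ⊔ span {a}))) (k + 1) := by
  let f : (R ⧸ J) →ₗ[R] (R ⧸ J) := LinearMap.lsmul R (R ⧸ J) a
  let g : (R ⧸ J) →ₗ[R] (R ⧸ (J ⊔ span {a})) :=
    Submodule.mapQ J (J ⊔ span {a}) LinearMap.id le_sup_left
  have hf : Function.Injective f := by
    rw [injective_iff_map_eq_zero]
    intro x hx
    obtain ⟨r, rfl⟩ := Ideal.Quotient.mk_surjective x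
    exact Ideal.Quotient.eq_zero_iff_mem.2 (ha r (Ideal.Quotient.eq_zero_iff_mem.1 hx))
  have hg : Function.Surjective g := fun x => by
    obtain ⟨r, rfl⟩ := Ideal.Quotient.mk_surjective x
    exact ⟨Ideal.Quotient.mk J r, rfl⟩
  have hfg : Function.Exact f g := by
    intro x
    obtain ⟨r, rfl⟩ := Ideal.Quotient.mk_surjective x
    refine (Ideal.Quotient.eq_zero_iff_mem (I := J ⊔ span {a}) (a := r)).trans ?_
    rw [Submodule.mem_sup]
    constructor
    · rintro ⟨y, hy, z, hz, rfl⟩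
      obtain ⟨c, rfl⟩ := Ideal.mem_span_singleton'.1 hz
      refine ⟨Ideal.Quotient.mk J c, ?_⟩
      refine Ideal.Quotient.eq.2 ?_
      simpa [mul_comm] using hy
    · rintro ⟨y, hy⟩
      obtain ⟨c, rfl⟩ := Ideal.Quotient.mk_surjective y
      have h : a * c - r ∈ J := Ideal.Quotient.eq.1 hy
      exact ⟨r - a * c, by simpa using J.neg_mem h, c * a,
        Ideal.mem_span_singleton'.2 ⟨c, rfl⟩, by ring⟩
  have hS := ModuleCat.shortComplex_shortExact
    (ModuleCat.shortComplexOfCompEqZero f g hfg.linearMap_comp_eq_zero) hfg hf hg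
  exact hS.hasProjectiveDimensionLT_X₃ k hJ (hasProjectiveDimensionLT_of_ge _ k _ k.le_succ)

end Ideal

namespace MvPolynomial

variable {T : Type u} [CommRing T] {n : ℕ}

/-- The ideal generated by the `t`-th powers of the first `k` variables. -/
def powVarsIdeal (T : Type u) [CommRing T] (n t k : ℕ) : Ideal (MvPolynomial (Fin n) T) :=
  Ideal.span ((fun i : Fin n => X i ^ t) '' {i | (i : ℕ) < k})

lemma mem_powVarsIdeal {t k : ℕ} {r : MvPolynomial (Fin n) T} :
    r ∈ powVarsIdeal T n t k ↔ ∀ m ∈ r.support, ∃ i : Fin n, (i : ℕ) < k ∧ t ≤ m i := by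
  have : (fun i : Fin n => (X i ^ t : MvPolynomial (Fin n) T)) '' {i | (i : ℕ) < k} =
      (fun s => monomial s (1 : T)) '' ((fun i => Finsupp.single i t) '' {i : Fin n | (i : ℕ) < k}) := by
    rw [Set.image_image]
    simp [X_pow_eq_monomial]
  rw [powVarsIdeal, this, mem_ideal_span_monomial_image]
  simp

lemma mem_powVarsIdeal_of_X_pow_mul_mem {t : ℕ} (k : Fin n) {r : MvPolynomial (Fin n) T}
    (h : X k ^ t * r ∈ powVarsIdeal T n t k) : r ∈ powVarsIdeal T n t k := by
  rw [mem_powVarsIdeal] at h ⊢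
  intro m hm
  obtain ⟨i, hi, hti⟩ := h (Finsupp.single k t + m) (by
    rw [mem_support_iff, X_pow_eq_monomial, coeff_monomial_mul, one_mul]
    exact mem_support_iff.1 hm)
  refine ⟨i, hi, ?_⟩
  have : k ≠ i := fun h => by simp [h] at hi
  simpa [Finsupp.single_apply, this] using hti

lemma hasProjectiveDimensionLT_quotient_powVarsIdeal (t : ℕ) {k : ℕ} (hk : k ≤ n) :
    HasProjectiveDimensionLT (ModuleCat.of (MvPolynomial (Fin n) T)
      (MvPolynomial (Fin n) T ⧸ powVarsIdeal T n t k)) (k + 1) := by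
  induction k with
  | zero =>
    rw [zero_add, ← projective_iff_hasProjectiveDimensionLT_one]
    have h0 : powVarsIdeal T n t 0 = ⊥ := by simp [powVarsIdeal]
    rw [h0]
    exact Projective.of_iso
      (Submodule.quotEquivOfEqBot (⊥ : Ideal (MvPolynomial (Fin n) T)) rfl).symm.toModuleIso
      (ModuleCat.projective_of_free (Module.Basis.singleton Unit (MvPolynomial (Fin n) T)))
  | succ k ih =>
    have hs : powVarsIdeal T n t (k + 1) = powVarsIdeal T n t k ⊔ Ideal.span {X ⟨k, hk⟩ ^ t} := by
      rw [powVarsIdeal, powVarsIdeal, ← Ideal.span_union]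
      congr 1
      ext p
      simp only [Set.mem_image, Set.mem_ofPred_eq, Set.mem_union, Set.mem_singleton_iff]
      constructor
      · rintro ⟨i, hi, rfl⟩
        rcases Nat.lt_succ_iff_lt_or_eq.1 hi with h | h
        · exact Or.inl ⟨i, h, rfl⟩
        · exact Or.inr (by subst h; rfl)
      · rintro (⟨i, hi, rfl⟩ | rfl)
        · exact ⟨i, by lia, rfl⟩
        · exact ⟨⟨k, hk⟩, by simp, rfl⟩
    rw [hs]
    exact Ideal.hasProjectiveDimensionLT_quotient_sup_span_singleton
      (fun r => mem_powVarsIdeal_of_X_pow_mul_mem ⟨k, hk⟩) (ih (by lia))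

lemma powVarsIdeal_le (t : ℕ) : powVarsIdeal T n t n ≤ idealOfVars (Fin n) T ^ t := by
  rw [powVarsIdeal, Ideal.span_le]
  rintro p ⟨i, -, rfl⟩
  exact Ideal.pow_mem_pow (Ideal.subset_span (Set.mem_range_self i)) t

lemma exists_pow_idealOfVars_le (t : ℕ) :
    ∃ s, t ≤ s ∧ idealOfVars (Fin n) T ^ s ≤ powVarsIdeal T n t n := by
  obtain ⟨k, hk⟩ := Ideal.exists_pow_le_of_le_radical_of_fg
    (I := idealOfVars (Fin n) T) (J := powVarsIdeal T n t n) (by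
      rw [idealOfVars, Ideal.span_le]
      rintro _ ⟨i, rfl⟩
      rw [SetLike.mem_coe, Ideal.mem_radical_iff]
      exact ⟨t, by rw [powVarsIdeal]; exact Ideal.subset_span ⟨i, i.2, rfl⟩⟩) (idealOfVars_fg _ _)
  exact ⟨max t k, le_max_left _ _, (Ideal.pow_le_pow_right (le_max_right _ _)).trans hk⟩

-- This is what makes top local cohomology right exact: for large `s` the projection factors through
-- the quotient by the `t`-th powers of the variables, whose projective dimension is at most `n`.
open localCohomology in
lemma exists_powProj_comp_eq_zero {t : ℕ} {M : ModuleCat.{u} (MvPolynomial (Fin n) T)}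
    (y : Abelian.Ext.{u} (powQuotient (idealOfVars (Fin n) T) t) M (n + 1)) :
    ∃ (s : ℕ) (h : t ≤ s),
      (Ext.mk₀ (powProj (J := idealOfVars (Fin n) T) h)).comp y (zero_add _) = 0 := by
  obtain ⟨s, h, hs⟩ := exists_pow_idealOfVars_le (T := T) (n := n) t
  refine ⟨s, h, ?_⟩
  have hfac : powProj (J := idealOfVars (Fin n) T) h =
      ModuleCat.ofHom (Submodule.mapQ _ (powVarsIdeal T n t n) LinearMap.id hs) ≫
      ModuleCat.ofHom (Submodule.mapQ _ _ LinearMap.id (powVarsIdeal_le t)) := by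
    ext
    rfl
  have := hasProjectiveDimensionLT_quotient_powVarsIdeal (T := T) t (le_refl n)
  rw [hfac, ← Ext.mk₀_comp_mk₀_assoc, Ext.eq_zero_of_hasProjectiveDimensionLT
    ((Ext.mk₀ _).comp y (zero_add _)) (n + 1) le_rfl, Ext.comp_zero]

end MvPolynomial
end

/-! ### Laurent polynomials and submodules cut out by exponents -/

noncomputable section
open MvPolynomial

/-- Laurent polynomials in `n` variables. -/
def MvLaurent (T : Type u) [CommRing T] (n : ℕ) : Type u := AddMonoidAlgebra T (Fin n →₀ ℤ)

namespace MvLaurent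

variable {T : Type u} [CommRing T] {n : ℕ}

instance : CommRing (MvLaurent T n) := inferInstanceAs (CommRing (AddMonoidAlgebra T (Fin n →₀ ℤ)))

/-- The inclusion of exponents of polynomials into exponents of Laurent polynomials. -/
def expMap (n : ℕ) : (Fin n →₀ ℕ) →+ (Fin n →₀ ℤ) :=
  Finsupp.mapRange.addMonoidHom (Nat.castAddMonoidHom ℤ)

@[simp]
lemma expMap_apply (m : Fin n →₀ ℕ) (i : Fin n) : expMap n m i = m i := rfl

/-- The inclusion of polynomials into Laurent polynomials. -/
def ofMvPolynomial : MvPolynomial (Fin n) T →+* MvLaurent T n :=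
  AddMonoidAlgebra.mapDomainRingHom T (expMap n)

instance : Algebra (MvPolynomial (Fin n) T) (MvLaurent T n) := ofMvPolynomial.toAlgebra

/-- The coefficient of a Laurent monomial. -/
def coeff (a : Fin n →₀ ℤ) : MvLaurent T n →+ T :=
  (Finsupp.applyAddHom a).comp AddMonoidAlgebra.coeffAddEquiv.toAddMonoidHom

@[ext]
lemma ext {u v : MvLaurent T n} (h : ∀ a, coeff a u = coeff a v) : u = v :=
  AddMonoidAlgebra.ext (Finsupp.ext h)

/-- The Laurent monomial with a given exponent. -/
def single (a : Fin n →₀ ℤ) : MvLaurent T n := AddMonoidAlgebra.single a 1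

lemma coeff_single_mul (a b : Fin n →₀ ℤ) (u : MvLaurent T n) :
    coeff b (single a * u) = coeff (-a + b) u :=
  (AddMonoidAlgebra.coeff_single_mul_apply (R := T) u 1 a b).trans (one_mul _)

lemma single_mul_single (a b : Fin n →₀ ℤ) :
    (single a * single b : MvLaurent T n) = single (a + b) :=
  (AddMonoidAlgebra.single_mul_single (R := T) a b 1 1).trans (by rw [mul_one]; rfl)

lemma single_zero : (single 0 : MvLaurent T n) = 1 := rfl

lemma coeff_single (a b : Fin n →₀ ℤ) [Decidable (a = b)] :
    coeff b (single a : MvLaurent T n) = if a = b then 1 else 0 := by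
  classical
  refine (Finsupp.single_apply (a := a) (a' := b) (b := (1 : T))).trans ?_
  congr

lemma coeff_monomial_smul (c : Fin n →₀ ℕ) (r : T) (a : Fin n →₀ ℤ) (u : MvLaurent T n) :
    coeff a (monomial c r • u) = r * coeff (-expMap n c + a) u := by
  rw [Algebra.smul_def]
  have : algebraMap (MvPolynomial (Fin n) T) (MvLaurent T n) (monomial c r) =
      AddMonoidAlgebra.single (expMap n c) r :=
    AddMonoidAlgebra.mapDomain_single
  rw [this]
  exact AddMonoidAlgebra.coeff_single_mul_apply u r (expMap n c) a

lemma coeff_smul (f : MvPolynomial (Fin n) T) (a : Fin n →₀ ℤ) (u : MvLaurent T n) :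
    coeff a (f • u) = ∑ c ∈ f.support, f.coeff c * coeff (-expMap n c + a) u := by
  conv_lhs => rw [f.as_sum, Finset.sum_smul, map_sum]
  simp_rw [coeff_monomial_smul]

lemma coeff_C_smul (r : T) (a : Fin n →₀ ℤ) (u : MvLaurent T n) :
    coeff a ((C r : MvPolynomial (Fin n) T) • u) = r * coeff a u := by
  rw [C_apply, coeff_monomial_smul]
  simp

lemma monomial_smul_single (c : Fin n →₀ ℕ) (r : T) (a : Fin n →₀ ℤ) :
    monomial c r • (single a : MvLaurent T n) =
      (C r : MvPolynomial (Fin n) T) • single (expMap n c + a) := by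
  classical
  ext b
  rw [coeff_monomial_smul, coeff_C_smul, coeff_single, coeff_single]
  congr 2
  rw [eq_neg_add_iff_add_eq]

lemma X_smul (i : Fin n) (u : MvLaurent T n) :
    (X i : MvPolynomial (Fin n) T) • u = single (Finsupp.single i 1) * u := by
  ext a
  rw [X, coeff_monomial_smul, coeff_single_mul, one_mul]
  congr
  ext j
  simp [Finsupp.single_apply]

/-- The Laurent polynomials with exponents in a given upper set. -/
def supported (T : Type u) [CommRing T] (S : UpperSet (Fin n →₀ ℤ)) :
    Submodule (MvPolynomial (Fin n) T) (MvLaurent T n) where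
  carrier := {u | ∀ a, a ∉ S → coeff a u = 0}
  add_mem' hu hv a ha := by rw [map_add, hu a ha, hv a ha, add_zero]
  zero_mem' a _ := map_zero _
  smul_mem' f u hu a ha := by
    rw [coeff_smul]
    refine Finset.sum_eq_zero fun c _ => ?_
    rw [hu, mul_zero]
    refine fun h => ha (S.upper (fun i => ?_) h)
    simp

lemma single_mul_mem_supported {S : UpperSet (Fin n →₀ ℤ)} {b : Fin n →₀ ℤ}
    (hb : ∀ a, a ∈ S → b + a ∈ S) {u : MvLaurent T n} (hu : u ∈ supported T S) :
    single b * u ∈ supported T S := by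
  intro a ha
  rw [coeff_single_mul]
  exact hu _ fun h => ha (by simpa using hb _ h)

/-- The part of a Laurent polynomial with exponents in a given set. -/
def restrict (S : Set (Fin n →₀ ℤ)) (u : MvLaurent T n) : MvLaurent T n :=
  open Classical in AddMonoidAlgebra.ofCoeff (Finsupp.filter (· ∈ S) (AddMonoidAlgebra.coeff u))

open Classical in
lemma coeff_restrict (S : Set (Fin n →₀ ℤ)) (u : MvLaurent T n) (a : Fin n →₀ ℤ) :
    coeff a (restrict S u) = if a ∈ S then coeff a u else 0 :=
  Finsupp.filter_apply (· ∈ S) (AddMonoidAlgebra.coeff u) a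

end MvLaurent
end

/-! ### Subquotients of Laurent polynomials and their short exact sequences -/

noncomputable section
open MvPolynomial CategoryTheory Abelian

namespace MvLaurent

variable (T : Type u) [CommRing T] {n : ℕ}

/-- The subquotient of the Laurent polynomials with exponents in `S` but not in `V`. -/
abbrev Subquotient (S V : UpperSet (Fin n →₀ ℤ)) : Type u :=
  supported T S ⧸ (supported T V).submoduleOf (supported T S)

variable {T}

lemma supported_mono {S S' : UpperSet (Fin n →₀ ℤ)} (h : ∀ a ∈ S, a ∈ S') :
    supported T S ≤ supported T S' := fun _ hu a ha => hu a fun h' => ha (h a h')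

/-- The inclusion of subquotients. -/
def subquotientInclusion {S S' : UpperSet (Fin n →₀ ℤ)} (V : UpperSet (Fin n →₀ ℤ))
    (h : ∀ a ∈ S, a ∈ S') :
    Subquotient T S V →ₗ[MvPolynomial (Fin n) T] Subquotient T S' V :=
  Submodule.mapQ _ _ (Submodule.inclusion (supported_mono h)) fun _ hu => hu

/-- The projection of subquotients. -/
def subquotientProjection (S : UpperSet (Fin n →₀ ℤ)) {V V' : UpperSet (Fin n →₀ ℤ)}
    (h : ∀ a ∈ V, a ∈ V') :
    Subquotient T S V →ₗ[MvPolynomial (Fin n) T] Subquotient T S V' :=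
  Submodule.mapQ _ _ LinearMap.id fun _ hu => supported_mono h hu

lemma subquotientInclusion_injective {S S' : UpperSet (Fin n →₀ ℤ)} (V : UpperSet (Fin n →₀ ℤ))
    (h : ∀ a ∈ S, a ∈ S') : Function.Injective (subquotientInclusion (T := T) V h) := by
  rw [injective_iff_map_eq_zero]
  intro x hx
  obtain ⟨u, rfl⟩ := Submodule.Quotient.mk_surjective _ x
  exact (Submodule.Quotient.mk_eq_zero _).2 ((Submodule.Quotient.mk_eq_zero _).1 hx :)

lemma subquotientProjection_surjective (S : UpperSet (Fin n →₀ ℤ)) {V V' : UpperSet (Fin n →₀ ℤ)}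
    (h : ∀ a ∈ V, a ∈ V') : Function.Surjective (subquotientProjection (T := T) S h) := fun x => by
  obtain ⟨u, rfl⟩ := Submodule.Quotient.mk_surjective _ x
  exact ⟨Submodule.Quotient.mk u, rfl⟩

lemma exact_subquotient {S S' V V' : UpperSet (Fin n →₀ ℤ)} (hS : ∀ a ∈ S, a ∈ S')
    (hV : ∀ a ∈ V, a ∈ V') (hSV : ∀ a ∈ S, a ∈ V') (hV' : ∀ a ∈ V', a ∈ S' → a ∈ S ∨ a ∈ V) :
    Function.Exact (subquotientInclusion (T := T) V hS) (subquotientProjection S' hV) := by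
  classical
  intro x
  obtain ⟨u, rfl⟩ := Submodule.Quotient.mk_surjective _ x
  refine (Submodule.Quotient.mk_eq_zero _).trans ⟨fun hu => ?_, ?_⟩
  -- The preimage keeps the terms with exponent in `S`; by `hV'` the discarded ones have exponent in
  -- `V`.
  · refine ⟨Submodule.Quotient.mk ⟨restrict S u.1, fun a ha => ?_⟩, ?_⟩
    · exact (coeff_restrict _ _ _).trans (if_neg ha)
    · refine (Submodule.Quotient.eq _).2 fun a ha => ?_
      change coeff a (restrict S u.1 - u.1) = 0
      rw [map_sub, coeff_restrict]
      split_ifs with h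
      · rw [sub_self]
      · rw [zero_sub, neg_eq_zero]
        by_cases h1 : a ∈ S'
        · by_cases h2 : a ∈ V'
          · exact absurd (hV' a h2 h1) (not_or.2 ⟨h, ha⟩)
          · exact hu a h2
        · exact u.2 a h1
  · rintro ⟨y, hy⟩
    obtain ⟨w, rfl⟩ := Submodule.Quotient.mk_surjective _ y
    have h := (supported T V').sub_mem (supported_mono hSV w.2)
      (supported_mono hV ((Submodule.Quotient.eq _).1 hy :))
    have h' : u.1 ∈ supported T V' := by simpa using h
    exact h'

/-- A variable whose translations preserve both supports acts bijectively on a subquotient. -/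
lemma X_smul_bijective_subquotient {S V : UpperSet (Fin n →₀ ℤ)} (i : Fin n)
    (hS : ∀ a ∈ S, -Finsupp.single i 1 + a ∈ S) (hV : ∀ a ∈ V, -Finsupp.single i 1 + a ∈ V) :
    Function.Bijective fun x : Subquotient T S V => (X i : MvPolynomial (Fin n) T) • x := by
  have hinv : ∀ u : MvLaurent T n,
      single (-Finsupp.single i 1) * ((X i : MvPolynomial (Fin n) T) • u) = u := fun u => by
    rw [X_smul, ← mul_assoc, single_mul_single, neg_add_cancel, single_zero, one_mul]
  have hinv' : ∀ u : MvLaurent T n,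
      (X i : MvPolynomial (Fin n) T) • (single (-Finsupp.single i 1) * u) = u := fun u => by
    rw [X_smul, ← mul_assoc, single_mul_single, add_neg_cancel, single_zero, one_mul]
  constructor
  · refine (injective_iff_map_eq_zero
      (LinearMap.lsmul (MvPolynomial (Fin n) T) (Subquotient T S V) (X i))).2 ?_
    intro x hx
    obtain ⟨u, rfl⟩ := Submodule.Quotient.mk_surjective _ x
    refine (Submodule.Quotient.mk_eq_zero _).2 ?_
    have h0 : (X i : MvPolynomial (Fin n) T) • u ∈ (supported T V).submoduleOf (supported T S) :=
      (Submodule.Quotient.mk_eq_zero _).1 hx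
    have h : (X i : MvPolynomial (Fin n) T) • u.1 ∈ supported T V := h0
    have := single_mul_mem_supported hV h
    rwa [hinv] at this
  · intro x
    obtain ⟨u, rfl⟩ := Submodule.Quotient.mk_surjective _ x
    refine ⟨Submodule.Quotient.mk ⟨_, single_mul_mem_supported hS u.2⟩, ?_⟩
    refine congr_arg Submodule.Quotient.mk (Subtype.ext ?_)
    exact hinv' u.1

variable (n) in
/-- Exponents which are nonnegative from index `j` on. -/
def tailNonneg (j : ℕ) : UpperSet (Fin n →₀ ℤ) :=
  ⟨{a | ∀ i : Fin n, j ≤ i → 0 ≤ a i}, fun _ _ hab ha i hi => (ha i hi).trans (hab i)⟩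

variable (n) in
/-- Exponents which are somewhere nonnegative before index `j`. -/
def headNonneg (j : ℕ) : UpperSet (Fin n →₀ ℤ) :=
  ⟨{a | ∃ i : Fin n, (i : ℕ) < j ∧ 0 ≤ a i}, fun _ _ hab ⟨i, hi, h⟩ => ⟨i, hi, h.trans (hab i)⟩⟩

variable (T n) in
/-- The partial top local cohomology modules of the polynomial ring: the Laurent polynomials whose
exponents are negative before index `j`, and nonnegative from `j` on. -/
abbrev Partial (j : ℕ) : Type u := Subquotient T (tailNonneg n j) (headNonneg n j)

variable (T n) in
/-- The localization of `Partial T n j` at the variable of index `j`. -/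
abbrev PartialLoc (j : ℕ) : Type u := Subquotient T (tailNonneg n (j + 1)) (headNonneg n j)

lemma tailNonneg_mono (j : ℕ) : ∀ a ∈ tailNonneg n j, a ∈ tailNonneg n (j + 1) :=
  fun _ ha i hi => ha i (by lia)

lemma headNonneg_mono (j : ℕ) : ∀ a ∈ headNonneg n j, a ∈ headNonneg n (j + 1) :=
  fun _ ha => by
  obtain ⟨i, hi, h⟩ := ha
  exact ⟨i, by lia, h⟩

lemma exact_partial {j : ℕ} (hj : j < n) :
    Function.Exact (subquotientInclusion (T := T) (headNonneg n j) (tailNonneg_mono j))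
      (subquotientProjection (tailNonneg n (j + 1)) (headNonneg_mono j)) := by
  refine exact_subquotient _ _ (fun a ha => ⟨⟨j, hj⟩, by simp, ha _ le_rfl⟩) fun a ha h' => ?_
  obtain ⟨i, hi, h⟩ := ha
  rcases Nat.lt_succ_iff_lt_or_eq.1 hi with hij | hij
  · exact Or.inr ⟨i, hij, h⟩
  · refine Or.inl fun k hk => ?_
    rcases hk.lt_or_eq with hk | hk
    · exact h' k hk
    · rwa [show k = i from Fin.ext (hk.symm.trans hij.symm)]

variable (T n) in
/-- The sequence embedding a partial local cohomology module in its localization. -/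
abbrev partialShortComplex {j : ℕ} (hj : j < n) :
    ShortComplex (ModuleCat.{u} (MvPolynomial (Fin n) T)) :=
  ModuleCat.shortComplexOfCompEqZero
    (subquotientInclusion (T := T) (headNonneg n j) (tailNonneg_mono j))
    (subquotientProjection (tailNonneg n (j + 1)) (headNonneg_mono j))
    (exact_partial hj).linearMap_comp_eq_zero

lemma shortExact_partialShortComplex {j : ℕ} (hj : j < n) :
    (partialShortComplex T n hj).ShortExact :=
  ModuleCat.shortComplex_shortExact _ (exact_partial hj)
    (subquotientInclusion_injective _ (tailNonneg_mono j))
    (subquotientProjection_surjective _ (headNonneg_mono j))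

/-- Neither support condition constrains the exponent at `j`, so both are stable under division by
`X j`. -/
lemma X_smul_bijective_partialLoc (j : Fin n) :
    Function.Bijective fun x : PartialLoc T n j => (X j : MvPolynomial (Fin n) T) • x := by
  apply X_smul_bijective_subquotient
  · intro a ha i hi
    have : j ≠ i := fun h => by simp [h] at hi
    simpa [Finsupp.single_apply, this] using ha i hi
  · rintro a ⟨i, hi, h⟩
    have : j ≠ i := fun h => by simp [h] at hi
    exact ⟨i, hi, by simpa [Finsupp.single_apply, this] using h⟩

end MvLaurent
end

/-! ### Dimension shifting from the polynomial ring to inverse polynomials -/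

noncomputable section
open MvPolynomial CategoryTheory Abelian localCohomology

namespace CategoryTheory.Abelian.Ext

lemma comp_mk₀_bijective {C : Type u} [Category.{v} C] [Abelian C] [HasExt.{w} C] (N : C)
    {Y Z : C} (f : Y ⟶ Z) [IsIso f] (i : ℕ) :
    Function.Bijective fun x : Ext N Y i => x.comp (mk₀ f) (add_zero i) := by
  refine Function.bijective_iff_has_inverse.2
    ⟨fun x => x.comp (mk₀ (inv f)) (add_zero i), fun x => ?_, fun x => ?_⟩ <;> simp

lemma comp_extClass_bijective {C : Type u} [Category.{v} C] [Abelian C] [HasExt.{w} C] {N : C}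
    {S : ShortComplex C} (hS : S.ShortExact) (h : ∀ (i : ℕ) (x : Ext N S.X₂ i), x = 0) (i : ℕ) :
    Function.Bijective fun x : Ext N S.X₃ i => x.comp hS.extClass (rfl : i + 1 = i + 1) := by
  constructor
  · refine (injective_iff_map_eq_zero (hS.extClass.postcomp N (rfl : i + 1 = i + 1))).2
      fun x hx => ?_
    obtain ⟨y, rfl⟩ := covariant_sequence_exact₃ N hS x rfl hx
    rw [h i y, zero_comp]
  · intro x
    exact covariant_sequence_exact₁ N hS x (h _ _) rfl

variable {R : Type u} [CommRing R]

/-- `a ^ t` acts on this Ext as zero through `N` and invertibly through `L`. -/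
lemma eq_zero_of_smul_bijective {N L : ModuleCat.{u} R} {a : R}
    (hL : Function.Bijective fun x : L => a • x) {t : ℕ} (hN : ∀ x : N, a ^ t • x = 0) {i : ℕ}
    (x : Ext.{u} N L i) : x = 0 := by
  have hL' : Function.Bijective (a ^ t • 𝟙 L : L ⟶ L) := by
    have : ⇑(a ^ t • 𝟙 L : L ⟶ L) = (fun x : L => a • x)^[t] := by
      rw [smul_iterate]
      rfl
    rw [this]
    exact hL.iterate t
  have : IsIso (a ^ t • 𝟙 L : L ⟶ L) := (ConcreteCategory.isIso_iff_bijective _).2 hL'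
  apply (comp_mk₀_bijective N (a ^ t • 𝟙 L) i).1
  have hN' : (a ^ t • 𝟙 N : N ⟶ N) = 0 := by
    ext x
    exact hN x
  change x.comp _ _ = (0 : Ext N L i).comp _ _
  rw [← smul_eq_comp_mk₀, zero_comp, ← mk₀_id_comp x, ← smul_comp, ← mk₀_smul, hN', mk₀_zero,
    zero_comp]

end CategoryTheory.Abelian.Ext

namespace MvLaurent

variable (T : Type u) [CommRing T] {n : ℕ}

/-- `ξ` is the product of the connecting classes; each shifts degree bijectively because Ext into
the localized middle term vanishes. A single class serving all `t` makes the bijections linear and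
compatible with the projections by associativity alone. -/
lemma exists_ext_partial {j : ℕ} (hj : j ≤ n) :
    ∃ ξ : Ext.{u} (ModuleCat.of (MvPolynomial (Fin n) T) (Partial T n j))
        (ModuleCat.of (MvPolynomial (Fin n) T) (Partial T n 0)) j,
      ∀ (t i k : ℕ) (h : i + j = k), Function.Bijective
        fun x : Ext.{u} (powQuotient (idealOfVars (Fin n) T) t) _ i => x.comp ξ h := by
  induction j with
  | zero =>
    refine ⟨Ext.mk₀ (𝟙 _), fun t i k h => ?_⟩
    subst h
    exact Ext.comp_mk₀_bijective _ (𝟙 _) i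
  | succ j ih =>
    obtain ⟨ξ, hξ⟩ := ih (by lia)
    refine ⟨(shortExact_partialShortComplex (T := T) hj).extClass.comp ξ (add_comm 1 j),
      fun t i k h => ?_⟩
    have h1 := Ext.comp_extClass_bijective (N := powQuotient (idealOfVars (Fin n) T) t)
      (shortExact_partialShortComplex (T := T) hj) (fun i x =>
        Ext.eq_zero_of_smul_bijective (t := t) (X_smul_bijective_partialLoc ⟨j, hj⟩) (fun y => by
          obtain ⟨r, rfl⟩ := Ideal.Quotient.mk_surjective y
          exact Ideal.Quotient.eq_zero_iff_mem.2 (Ideal.mul_mem_right _ _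
            (Ideal.pow_mem_pow (Ideal.subset_span (Set.mem_range_self _)) t))) x) i
    convert (hξ t (i + 1) k (by lia)).comp h1 using 2 with x
    exact (Ext.comp_assoc x _ ξ rfl (add_comm 1 j) (by lia)).symm

lemma expMap_injective : Function.Injective (expMap n) :=
  Finsupp.mapRange_injective _ rfl Nat.cast_injective

variable (n) in
/-- The polynomial ring is the first partial local cohomology module. -/
def toPartialZero : MvPolynomial (Fin n) T →ₗ[MvPolynomial (Fin n) T] Partial T n 0 :=
  Submodule.mkQ _ ∘ₗ LinearMap.codRestrict (supported T (tailNonneg n 0))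
    (Algebra.linearMap (MvPolynomial (Fin n) T) (MvLaurent T n)) (fun f a ha => by
      rw [Algebra.linearMap_apply, ← mul_one (algebraMap _ _ _), ← Algebra.smul_def,
        ← single_zero, coeff_smul]
      refine Finset.sum_eq_zero fun c _ => ?_
      classical
      rw [coeff_single, if_neg, mul_zero]
      rintro h
      refine ha fun i _ => ?_
      rw [eq_comm, neg_add_eq_zero] at h
      simp [← h])

lemma toPartialZero_bijective : Function.Bijective (toPartialZero T n) := by
  classical
  constructor
  · rw [injective_iff_map_eq_zero]
    intro f hf
    have h : ∀ a, coeff a (ofMvPolynomial f) = 0 := fun a =>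
      ((Submodule.Quotient.mk_eq_zero _).1 hf : _ ∈ (supported T (headNonneg n 0)).submoduleOf _) a
        fun ⟨i, hi, _⟩ => by simp at hi
    exact AddMonoidAlgebra.mapDomain_injective (R := T) expMap_injective
      ((MvLaurent.ext (v := 0) fun a => (h a).trans (map_zero _).symm).trans
        (map_zero ofMvPolynomial).symm)
  · intro x
    obtain ⟨u, rfl⟩ := Submodule.Quotient.mk_surjective _ x
    let f : MvPolynomial (Fin n) T := AddMonoidAlgebra.ofCoeff
      (Finsupp.comapDomain (expMap n) (AddMonoidAlgebra.coeff u.1) (expMap_injective.injOn))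
    refine ⟨f, congr_arg Submodule.Quotient.mk (Subtype.ext ?_)⟩
    apply AddMonoidAlgebra.ext
    refine Finsupp.mapDomain_comapDomain _ expMap_injective _ fun a ha => ?_
    have ha' : a ∈ tailNonneg n 0 := by
      by_contra h
      exact Finsupp.mem_support_iff.1 ha (u.2 a h)
    refine ⟨Finsupp.mapRange Int.toNat rfl a, ?_⟩
    ext i
    simpa using ha' i (Nat.zero_le _)

variable (n) in
/-- The top local cohomology of the polynomial ring: the inverse polynomials. -/
abbrev InversePolynomial : Type u := Partial T n n

variable (n) in
lemma exists_ext_inversePolynomial :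
    ∃ ξ : Ext.{u} (ModuleCat.of (MvPolynomial (Fin n) T) (InversePolynomial T n))
        (ModuleCat.of (MvPolynomial (Fin n) T) (MvPolynomial (Fin n) T)) n,
      ∀ t : ℕ, Function.Bijective
        fun φ : powQuotient (idealOfVars (Fin n) T) t ⟶ ModuleCat.of _ (InversePolynomial T n) =>
          (Ext.mk₀ φ).comp ξ (zero_add n) := by
  obtain ⟨ξ, hξ⟩ := exists_ext_partial T (le_refl n)
  let e : ModuleCat.of (MvPolynomial (Fin n) T) (Partial T n 0) ≅
      ModuleCat.of (MvPolynomial (Fin n) T) (MvPolynomial (Fin n) T) :=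
    (LinearEquiv.ofBijective _ (toPartialZero_bijective T)).symm.toModuleIso
  refine ⟨ξ.comp (Ext.mk₀ e.hom) (add_zero n), fun t => ?_⟩
  have h := (Ext.comp_mk₀_bijective _ e.hom n).comp
    ((hξ t 0 n (zero_add n)).comp (Ext.mk₀_bijective _ _))
  convert h using 2 with φ
  simp

end MvLaurent
end

/-! ### Inverse monomials -/

noncomputable section
open MvPolynomial

namespace MvLaurent

variable (T : Type u) [CommRing T] {n : ℕ}

/-- The exponent of the inverse monomial with index `b`. -/
def invExp (b : Fin n →₀ ℕ) : Fin n →₀ ℤ := Finsupp.equivFunOnFinite.symm fun i => -(b i : ℤ) - 1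

@[simp]
lemma invExp_apply (b : Fin n →₀ ℕ) (i : Fin n) : invExp b i = -(b i : ℤ) - 1 := rfl

lemma invExp_notMem (b : Fin n →₀ ℕ) : invExp b ∉ headNonneg n n := by
  rintro ⟨i, -, h⟩
  rw [invExp_apply] at h
  lia

/-- The class of a Laurent polynomial, as an inverse polynomial. -/
def toInverse : MvLaurent T n →ₗ[MvPolynomial (Fin n) T] InversePolynomial T n :=
  Submodule.mkQ _ ∘ₗ LinearMap.codRestrict (supported T (tailNonneg n n)) LinearMap.id
    (fun _ _ ha => absurd (fun i hi => absurd i.2 (by lia)) ha)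

lemma toInverse_surjective : Function.Surjective (toInverse T (n := n)) := fun x => by
  obtain ⟨u, rfl⟩ := Submodule.Quotient.mk_surjective _ x
  exact ⟨u.1, rfl⟩

variable {T}

lemma toInverse_eq_zero_iff {u : MvLaurent T n} :
    toInverse T u = 0 ↔ u ∈ supported T (headNonneg n n) :=
  Submodule.Quotient.mk_eq_zero _

variable (T) in
/-- The inverse monomials. -/
def inverseMonomial (b : Fin n →₀ ℕ) : InversePolynomial T n := toInverse T (single (invExp b))

open Classical in
lemma monomial_smul_inverseMonomial (c b : Fin n →₀ ℕ) (r : T) :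
    monomial c r • inverseMonomial T b =
      if c ≤ b then (C r : MvPolynomial (Fin n) T) • inverseMonomial T (b - c) else 0 := by
  rw [inverseMonomial, ← map_smul, monomial_smul_single]
  split_ifs with h
  · rw [inverseMonomial, ← map_smul]
    congr 3
    ext i
    have := h i
    simp only [Finsupp.add_apply, expMap_apply, invExp_apply, Finsupp.tsub_apply]
    lia
  · rw [map_smul, toInverse_eq_zero_iff.2, smul_zero]
    intro a ha
    rw [coeff_single, if_neg]
    rintro rfl
    refine h fun i => ?_
    by_contra hi
    refine ha ⟨i, i.2, ?_⟩
    simp only [Finsupp.add_apply, expMap_apply, invExp_apply]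
    lia

lemma span_inverseMonomial :
    Submodule.span (MvPolynomial (Fin n) T) (Set.range (inverseMonomial T (n := n))) = ⊤ := by
  classical
  rw [eq_top_iff]
  intro x _
  obtain ⟨u, rfl⟩ := toInverse_surjective T x
  have hu : u = ∑ a ∈ (AddMonoidAlgebra.coeff u).support,
      (C (coeff a u) : MvPolynomial (Fin n) T) • single a := by
    ext b
    simp only [map_sum, coeff_C_smul, coeff_single, mul_ite, mul_one, mul_zero,
      Finset.sum_ite_eq']
    split_ifs with h
    · rfl
    · exact Finsupp.notMem_support_iff.1 h
  rw [hu, map_sum]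
  refine Submodule.sum_mem _ fun a _ => ?_
  rw [map_smul]
  refine Submodule.smul_mem _ _ ?_
  by_cases ha : a ∈ headNonneg n n
  · rw [toInverse_eq_zero_iff.2]
    · exact Submodule.zero_mem _
    · intro b hb
      rw [coeff_single, if_neg]
      rintro rfl
      exact hb ha
  · refine Submodule.subset_span ⟨Finsupp.equivFunOnFinite.symm fun i => (-a i - 1).toNat, ?_⟩
    rw [inverseMonomial]
    congr 2
    ext i
    have : ¬ 0 ≤ a i := fun h => ha ⟨i, i.2, h⟩
    simp only [invExp_apply, Finsupp.equivFunOnFinite_symm_apply_apply]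
    lia

lemma exists_pow_smul_eq_zero (v : InversePolynomial T n) :
    ∃ t, ∀ r ∈ idealOfVars (Fin n) T ^ t, r • v = 0 := by
  classical
  have hv : v ∈ Submodule.span (MvPolynomial (Fin n) T) (Set.range (inverseMonomial T (n := n))) :=
    span_inverseMonomial (T := T) (n := n) ▸ Submodule.mem_top
  induction hv using Submodule.span_induction with
  | mem x hx =>
    obtain ⟨b, rfl⟩ := hx
    refine ⟨b.degree + 1, fun r hr => ?_⟩
    rw [r.as_sum, Finset.sum_smul]
    refine Finset.sum_eq_zero fun c hc => ?_
    rw [monomial_smul_inverseMonomial, if_neg]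
    intro h
    have h1 := (mem_pow_idealOfVars_iff _ _).1 hr c hc
    have h2 := Finsupp.degree_mono h
    lia
  | zero => exact ⟨0, fun r _ => smul_zero r⟩
  | add x y _ _ hx hy =>
    obtain ⟨s, hs⟩ := hx
    obtain ⟨t, ht⟩ := hy
    refine ⟨max s t, fun r hr => ?_⟩
    rw [smul_add, hs r (Ideal.pow_le_pow_right (le_max_left _ _) hr),
      ht r (Ideal.pow_le_pow_right (le_max_right _ _) hr), add_zero]
  | smul a x _ hx =>
    obtain ⟨t, ht⟩ := hx
    exact ⟨t, fun r hr => by rw [smul_comm, ht r hr, smul_zero]⟩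

/-- Compare coefficients at the exponent $(-1,\dots,-1)$: on the left only the constant term of `s`
contributes, and on the right every coefficient of a multiple of `f` lies in `coeffIdeal f`. -/
lemma constantCoeff_mem_coeffIdeal {f s : MvPolynomial (Fin n) T} {w : InversePolynomial T n}
    (h : s • inverseMonomial T 0 = f • w) : constantCoeff s ∈ coeffIdeal f := by
  classical
  obtain ⟨u, rfl⟩ := toInverse_surjective T w
  rw [inverseMonomial, ← map_smul, ← map_smul, ← sub_eq_zero, ← map_sub,
    toInverse_eq_zero_iff] at h
  have h0 := h (invExp 0) (invExp_notMem 0)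
  rw [map_sub, sub_eq_zero] at h0
  have h1 : coeff (invExp 0) (s • (single (invExp 0) : MvLaurent T n)) = constantCoeff s := by
    rw [coeff_smul, constantCoeff_eq]
    rw [Finset.sum_eq_single 0]
    · simp [coeff_single]
    · intro c _ hc
      rw [coeff_single, if_neg, mul_zero]
      intro h
      rw [right_eq_add, neg_eq_zero] at h
      exact hc (expMap_injective (h.trans (map_zero _).symm))
    · intro h
      rw [notMem_support_iff.1 h, zero_mul]
  rw [← h1, h0, coeff_smul]
  exact Ideal.sum_mem _ fun c hc => Ideal.mul_mem_right _ _
    (Ideal.subset_span (coeff_mem_coeffs _ (mem_support_iff.1 hc)))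

end MvLaurent
end

/-! ### Multiplication by f on inverse polynomials: the determinant argument -/

noncomputable section
open MvPolynomial

namespace MvLaurent

variable {T : Type u} [CommRing T] {n : ℕ}

open Classical in
/-- The matrix, in terms of inverse monomials of degree `d`, of multiplication by a homogeneous
polynomial `f` on the inverse monomials whose index is `a` plus an exponent of degree `d`. -/
def shiftMatrix (f : MvPolynomial (Fin n) T) (a : Fin n →₀ ℕ) (d : ℕ) :
    Matrix (Finset.finsuppAntidiag (Finset.univ : Finset (Fin n)) d)
      (Finset.finsuppAntidiag (Finset.univ : Finset (Fin n)) d) T :=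
  fun b b' => if b'.1 ≤ b.1 + a then f.coeff (b.1 + a - b'.1) else 0

lemma mem_finsuppAntidiag_univ {d : ℕ} {b : Fin n →₀ ℕ} :
    b ∈ Finset.finsuppAntidiag (Finset.univ : Finset (Fin n)) d ↔ b.degree = d := by
  simp [Finsupp.degree_eq_sum]

lemma smul_inverseMonomial {f : MvPolynomial (Fin n) T} {p : ℕ} (hf : f.IsHomogeneous p)
    {a : Fin n →₀ ℕ} (ha : a.degree = p) {d : ℕ}
    (b : Finset.finsuppAntidiag (Finset.univ : Finset (Fin n)) d) :
    f • inverseMonomial T (b.1 + a) =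
      ∑ b', (C (shiftMatrix f a d b b') : MvPolynomial (Fin n) T) • inverseMonomial T b'.1 := by
  classical
  set m := b.1 + a with hm
  have hdm : m.degree = d + p := by rw [hm, map_add, mem_finsuppAntidiag_univ.1 b.2, ha]
  have h1 : f • inverseMonomial T m =
      ∑ c ∈ Finset.Iic m, (C (f.coeff c) : MvPolynomial (Fin n) T) • inverseMonomial T (m - c) := by
    conv_lhs => rw [f.as_sum, Finset.sum_smul]
    simp_rw [monomial_smul_inverseMonomial]
    rw [← Finset.sum_filter]
    refine Finset.sum_subset (fun c hc => Finset.mem_Iic.2 (Finset.mem_filter.1 hc).2) ?_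
    intro c hc hc'
    have : c ∉ f.support := fun h => hc' (Finset.mem_filter.2 ⟨h, Finset.mem_Iic.1 hc⟩)
    rw [notMem_support_iff.1 this, C_0, zero_smul]
  have h2 : ∑ c ∈ Finset.Iic m, (C (f.coeff c) : MvPolynomial (Fin n) T) •
        inverseMonomial T (m - c) =
      ∑ c ∈ Finset.Iic m, (C (f.coeff (m - c)) : MvPolynomial (Fin n) T) • inverseMonomial T c := by
    refine Finset.sum_nbij' (m - ·) (m - ·) ?_ ?_ ?_ ?_ ?_
    · intro c _
      exact Finset.mem_Iic.2 tsub_le_self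
    · intro c _
      exact Finset.mem_Iic.2 tsub_le_self
    · intro c hc
      exact tsub_tsub_cancel_of_le (Finset.mem_Iic.1 hc)
    · intro c hc
      exact tsub_tsub_cancel_of_le (Finset.mem_Iic.1 hc)
    · intro c hc
      rw [tsub_tsub_cancel_of_le (Finset.mem_Iic.1 hc)]
  rw [h1, h2]
  simp only [shiftMatrix, ← hm]
  rw [Finset.sum_coe_sort (Finset.finsuppAntidiag (Finset.univ : Finset (Fin n)) d) fun b' =>
    (C (if b' ≤ m then f.coeff (m - b') else 0) : MvPolynomial (Fin n) T) • inverseMonomial T b']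
  have h3 : ∀ b', (C (if b' ≤ m then f.coeff (m - b') else 0) : MvPolynomial (Fin n) T) •
      inverseMonomial T b' = if b' ≤ m then
        (C (f.coeff (m - b')) : MvPolynomial (Fin n) T) • inverseMonomial T b' else 0 := fun b' => by
    split_ifs
    · rfl
    · rw [C_0, zero_smul]
  simp_rw [h3]
  rw [← Finset.sum_filter]
  refine (Finset.sum_subset (fun c hc => Finset.mem_Iic.2 (Finset.mem_filter.1 hc).2) ?_).symm
  intro c hc hc'
  -- By homogeneity only indices `c` of degree `d` survive: otherwise `m - c` does not have degree
  -- `p`.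
  rw [hf.coeff_eq_zero, C_0, zero_smul]
  intro hd
  refine hc' (Finset.mem_filter.2 ⟨mem_finsuppAntidiag_univ.2 ?_, Finset.mem_Iic.1 hc⟩)
  have h4 : (m - c).degree + c.degree = m.degree := by
    rw [← map_add, tsub_add_cancel_of_le (Finset.mem_Iic.1 hc)]
  lia

/-- The diagonal entries are `f.coeff a`. Below the diagonal `b' < b`, so the exponent `b + a - b'`
exceeds `a` and its coefficient lies in `q` by maximality. Modulo `q` the determinant is thus a
power of a nonzero element of a domain. -/
lemma det_shiftMatrix_notMem {f : MvPolynomial (Fin n) T} {q : Ideal T} [q.IsPrime]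
    {a : Fin n →₀ ℕ} (haq : f.coeff a ∉ q)
    (hmax : ∀ c, f.coeff c ∉ q → MonomialOrder.lex.toSyn c ≤ MonomialOrder.lex.toSyn a) (d : ℕ) :
    (shiftMatrix f a d).det ∉ q := by
  classical
  set m : MonomialOrder (Fin n) := MonomialOrder.lex
  let _ : LinearOrder (Finset.finsuppAntidiag (Finset.univ : Finset (Fin n)) d) :=
    LinearOrder.lift' (fun b => m.toSyn b.1) fun _ _ h => Subtype.ext (m.toSyn.injective h)
  rw [← Ideal.Quotient.eq_zero_iff_mem, RingHom.map_det, Matrix.det_of_isUpperTriangular]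
  · refine Finset.prod_ne_zero_iff.2 fun b _ => ?_
    rw [RingHom.mapMatrix_apply, Matrix.map_apply, Ne, Ideal.Quotient.eq_zero_iff_mem, shiftMatrix,
      if_pos le_self_add, add_tsub_cancel_left]
    exact haq
  · intro b b' hbb'
    rw [RingHom.mapMatrix_apply, Matrix.map_apply, Ideal.Quotient.eq_zero_iff_mem, shiftMatrix]
    split_ifs with h
    · by_contra hc
      have h1 := hmax _ hc
      have h2 : m.toSyn (b.1 + a - b'.1) + m.toSyn b'.1 = m.toSyn b.1 + m.toSyn a := by
        rw [← map_add, tsub_add_cancel_of_le h, map_add]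
      have h3 : m.toSyn b'.1 < m.toSyn b.1 := hbb'
      have h4 := add_lt_add_of_le_of_lt h1 h3
      rw [h2, add_comm] at h4
      exact lt_irrefl _ h4
    · exact q.zero_mem

lemma exists_C_smul_inverseMonomial {f : MvPolynomial (Fin n) T} {p : ℕ} (hf : f.IsHomogeneous p)
    {q : Ideal T} [q.IsPrime] (hq : ¬ coeffIdeal f ≤ q) (b : Fin n →₀ ℕ) :
    ∃ s ∉ q, ∃ w : InversePolynomial T n,
      (C s : MvPolynomial (Fin n) T) • inverseMonomial T b = f • w := by
  classical
  obtain ⟨a, ha, hmax⟩ : ∃ a, f.coeff a ∉ q ∧ ∀ c, f.coeff c ∉ q →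
      MonomialOrder.lex.toSyn c ≤ MonomialOrder.lex.toSyn a := by
    have hsub : ∀ c, f.coeff c ∉ q → c ∈ f.support.filter fun c => f.coeff c ∉ q := fun c hc =>
      Finset.mem_filter.2 ⟨mem_support_iff.2 fun h => hc (h ▸ q.zero_mem), hc⟩
    have hne : (f.support.filter fun c => f.coeff c ∉ q).Nonempty := by
      by_contra hne
      refine hq (Ideal.span_le.2 fun r hr => ?_)
      obtain ⟨c, -, rfl⟩ := mem_coeffs_iff.1 hr
      by_contra hc
      exact hne ⟨c, hsub c hc⟩
    obtain ⟨a, ha, h⟩ := Finset.exists_max_image _ (MonomialOrder.lex.toSyn ·) hne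
    exact ⟨a, (Finset.mem_filter.1 ha).2, fun c hc => h c (hsub c hc)⟩
  have hdeg : a.degree = p := by
    by_contra h
    exact ha (hf.coeff_eq_zero h ▸ q.zero_mem)
  set A := shiftMatrix f a b.degree
  let b₀ : Finset.finsuppAntidiag (Finset.univ : Finset (Fin n)) b.degree :=
    ⟨b, mem_finsuppAntidiag_univ.2 rfl⟩
  -- Cramer's rule: row `b₀` of the adjugate, times `A`, is `A.det` at `b₀` and zero elsewhere.
  refine ⟨A.det, det_shiftMatrix_notMem ha hmax _, ∑ b₁, (C (A.adjugate b₀ b₁) :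
    MvPolynomial (Fin n) T) • inverseMonomial T (b₁.1 + a), ?_⟩
  simp_rw [Finset.smul_sum, smul_comm f, smul_inverseMonomial hf hdeg, Finset.smul_sum, smul_smul,
    ← C_mul]
  rw [Finset.sum_comm]
  simp_rw [← Finset.sum_smul, ← map_sum, ← Matrix.mul_apply]
  rw [Finset.sum_eq_single b₀]
  · rw [Matrix.adjugate_mul, Matrix.smul_apply, Matrix.one_apply_eq, smul_eq_mul, mul_one]
  · intro b₁ _ hb
    rw [Matrix.adjugate_mul, Matrix.smul_apply, Matrix.one_apply_ne hb.symm, smul_zero, C_0,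
      zero_smul]
  · exact fun h => absurd (Finset.mem_univ _) h

lemma exists_smul_mem_smul {f : MvPolynomial (Fin n) T} {p : ℕ} (hf : f.IsHomogeneous p)
    {Q : Ideal (MvPolynomial (Fin n) T)} [Q.IsPrime] (hQ : ¬ (coeffIdeal f).map C ≤ Q)
    (v : InversePolynomial T n) :
    ∃ s ∉ Q, ∃ w : InversePolynomial T n, s • v = f • w := by
  have hv : v ∈ Submodule.span (MvPolynomial (Fin n) T) (Set.range (inverseMonomial T (n := n))) :=
    span_inverseMonomial (T := T) (n := n) ▸ Submodule.mem_top
  induction hv using Submodule.span_induction with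
  | mem x hx =>
    obtain ⟨b, rfl⟩ := hx
    obtain ⟨s, hs, w, h⟩ := exists_C_smul_inverseMonomial hf (q := Q.comap C)
      (fun h => hQ (Ideal.map_le_iff_le_comap.2 h)) b
    exact ⟨C s, hs, w, h⟩
  | zero => exact ⟨1, fun h => Ideal.IsPrime.ne_top ‹_› ((Ideal.eq_top_iff_one _).2 h), 0, by simp⟩
  | add x y _ _ hx hy =>
    obtain ⟨s, hs, w, h⟩ := hx
    obtain ⟨s', hs', w', h'⟩ := hy
    refine ⟨s * s', fun hss => (Ideal.IsPrime.mem_or_mem ‹_› hss).elim hs hs', s' • w + s • w', ?_⟩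
    rw [smul_add, smul_add, mul_comm s s', mul_smul, h, mul_comm s' s, mul_smul, h',
      smul_comm f s', smul_comm f s]
  | smul r x _ hx =>
    obtain ⟨s, hs, w, h⟩ := hx
    exact ⟨s, hs, r • w, by rw [smul_comm, h, smul_comm]⟩

end MvLaurent
end

/-! ### The support of the top local cohomology module -/

noncomputable section
open MvPolynomial CategoryTheory Abelian localCohomology

namespace MvPolynomial

variable {T : Type u} [CommRing T] {n : ℕ}

lemma exists_ext_comp_eq {S : ShortComplex (ModuleCat.{u} (MvPolynomial (Fin n) T))}
    (hS : S.ShortExact) {t : ℕ}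
    (y : Ext.{u} (powQuotient (idealOfVars (Fin n) T) t) S.X₃ n) :
    ∃ (s : ℕ) (h : t ≤ s) (w : Ext.{u} (powQuotient (idealOfVars (Fin n) T) s) S.X₂ n),
      w.comp (Ext.mk₀ S.g) (add_zero n) = (Ext.mk₀ (powProj h)).comp y (zero_add n) := by
  obtain ⟨s, h, hs⟩ := exists_powProj_comp_eq_zero (y.comp hS.extClass rfl)
  refine ⟨s, h, Ext.covariant_sequence_exact₃ _ hS _ rfl ?_⟩
  rw [← hs]
  exact Ext.comp_assoc _ _ _ _ _ (by lia)

/-- The quotient map `R → R ⧸ f R`, as a morphism of modules. -/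
abbrev quotientSpanMk (f : MvPolynomial (Fin n) T) :
    ModuleCat.of (MvPolynomial (Fin n) T) (MvPolynomial (Fin n) T) ⟶
      ModuleCat.of (MvPolynomial (Fin n) T) (MvPolynomial (Fin n) T ⧸ Ideal.span {f}) :=
  ModuleCat.ofHom (Submodule.mkQ (Ideal.span {f}))

lemma smul_quotientSpanMk (f : MvPolynomial (Fin n) T) : f • quotientSpanMk f = 0 := by
  ext
  refine (Submodule.Quotient.mk_eq_zero _).2 ?_
  simp

lemma exists_ext_comp_quotientSpanMk_eq (f : MvPolynomial (Fin n) T) {t : ℕ}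
    (y : Ext.{u} (powQuotient (idealOfVars (Fin n) T) t) (ModuleCat.of (MvPolynomial (Fin n) T)
      (MvPolynomial (Fin n) T ⧸ Ideal.span {f})) n) :
    ∃ (s : ℕ) (h : t ≤ s) (w : Ext.{u} (powQuotient (idealOfVars (Fin n) T) s)
        (ModuleCat.of (MvPolynomial (Fin n) T) (MvPolynomial (Fin n) T)) n),
      w.comp (Ext.mk₀ (quotientSpanMk f)) (add_zero n) =
        (Ext.mk₀ (powProj h)).comp y (zero_add n) :=
  exists_ext_comp_eq (LinearMap.shortExact_shortComplexKer
    (Submodule.mkQ_surjective (Ideal.span {f}))) y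

/-- `w` comes from a class with values in the ideal `f R`. Since `f` may be a zero divisor, `f R`
need not be isomorphic to `R`, so the class is lifted along the surjection `R → f R` by a second use
of right exactness. -/
lemma exists_powProj_comp_eq_smul (f : MvPolynomial (Fin n) T) {t : ℕ}
    (w : Ext.{u} (powQuotient (idealOfVars (Fin n) T) t)
      (ModuleCat.of (MvPolynomial (Fin n) T) (MvPolynomial (Fin n) T)) n)
    (hw : w.comp (Ext.mk₀ (quotientSpanMk f)) (add_zero n) = 0) :
    ∃ (s : ℕ) (h : t ≤ s) (w' : Ext.{u} (powQuotient (idealOfVars (Fin n) T) s)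
        (ModuleCat.of (MvPolynomial (Fin n) T) (MvPolynomial (Fin n) T)) n),
      (Ext.mk₀ (powProj h)).comp w (zero_add n) = f • w' := by
  have hS := LinearMap.shortExact_shortComplexKer (Submodule.mkQ_surjective (Ideal.span {f}))
  obtain ⟨x, rfl⟩ := Ext.covariant_sequence_exact₂ _ hS w hw
  let g : MvPolynomial (Fin n) T →ₗ[MvPolynomial (Fin n) T]
      LinearMap.ker (Submodule.mkQ (Ideal.span {f})) :=
    LinearMap.codRestrict _ (LinearMap.toSpanSingleton _ _ f) fun r => by
      rw [Submodule.ker_mkQ]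
      exact Ideal.mul_mem_left _ _ (Ideal.mem_span_singleton_self f)
  have hg : Function.Surjective g := by
    rintro ⟨r, hr⟩
    rw [Submodule.ker_mkQ] at hr
    obtain ⟨a, rfl⟩ := Ideal.mem_span_singleton'.1 hr
    exact ⟨a, rfl⟩
  obtain ⟨s, h, w', hw'⟩ := exists_ext_comp_eq (LinearMap.shortExact_shortComplexKer hg) x
  refine ⟨s, h, w', ?_⟩
  rw [← Ext.comp_assoc_of_third_deg_zero, ← hw', Ext.comp_assoc_of_third_deg_zero,
    Ext.mk₀_comp_mk₀, Ext.smul_eq_comp_mk₀]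
  congr 2
  ext
  simp [g]

lemma mem_of_constantCoeff_mem {Q : Ideal (MvPolynomial (Fin n) T)}
    (hI : idealOfVars (Fin n) T ≤ Q) {s : MvPolynomial (Fin n) T}
    (hs : (C (constantCoeff s) : MvPolynomial (Fin n) T) ∈ Q) : s ∈ Q := by
  have h : s - C (constantCoeff s) ∈ idealOfVars (Fin n) T := by
    rw [← pow_one (idealOfVars (Fin n) T), mem_pow_idealOfVars_iff']
    intro x hx
    obtain rfl : x = 0 := (Finsupp.degree_eq_zero_iff x).1 (by lia)
    rw [coeff_sub, coeff_zero_C, constantCoeff_eq, sub_self]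
  simpa using Q.add_mem (hI h) hs

end MvPolynomial

namespace MvLaurent

variable {T : Type u} [CommRing T] {n : ℕ}

lemma exists_hom_apply_one (v : InversePolynomial T n) {s : ℕ} :
    ∃ (t : ℕ) (_ : s ≤ t) (φ : powQuotient (idealOfVars (Fin n) T) t ⟶
      ModuleCat.of (MvPolynomial (Fin n) T) (InversePolynomial T n)),
      φ (Ideal.Quotient.mk _ 1) = v := by
  obtain ⟨t, ht⟩ := exists_pow_smul_eq_zero v
  refine ⟨max s t, le_max_left _ _, ModuleCat.ofHom (Submodule.liftQ _
    (LinearMap.toSpanSingleton _ _ v)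
    fun r hr => ht r (Ideal.pow_le_pow_right (le_max_right _ _) hr)), ?_⟩
  exact one_smul (MvPolynomial (Fin n) T) v

lemma hom_ext_one {t : ℕ} {φ ψ : powQuotient (idealOfVars (Fin n) T) t ⟶
      ModuleCat.of (MvPolynomial (Fin n) T) (InversePolynomial T n)}
    (h : φ (Ideal.Quotient.mk _ 1) = ψ (Ideal.Quotient.mk _ 1)) : φ = ψ := by
  ext
  exact h

end MvLaurent

open MvLaurent

variable {T : Type u} [CommRing T] {n : ℕ}

lemma topLocalCohomology_exists_smul_eq_zero_of_not_idealOfVars_le (f : MvPolynomial (Fin n) T)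
    {Q : Ideal (MvPolynomial (Fin n) T)} [hQ : Q.IsPrime] (hI : ¬ idealOfVars (Fin n) T ≤ Q)
    (z : topLocalCohomology f) : ∃ s ∉ Q, s • z = 0 := by
  obtain ⟨a, ha, haQ⟩ := Set.not_subset.1 hI
  obtain ⟨t, y, rfl⟩ := exists_ofExt_eq _ _ _ z
  refine ⟨a ^ t, fun h => haQ (hQ.mem_of_pow_mem t h), ?_⟩
  have h0 : (a ^ t • 𝟙 (powQuotient (idealOfVars (Fin n) T) t) : _ ⟶ _) = 0 := by
    ext
    exact Ideal.Quotient.eq_zero_iff_mem.2 (Ideal.mul_mem_right _ _ (Ideal.pow_mem_pow ha t))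
  rw [← map_smul, ← Ext.mk₀_id_comp y, ← Ext.smul_comp, ← Ext.mk₀_smul, h0, Ext.mk₀_zero,
    Ext.zero_comp, map_zero]

lemma topLocalCohomology_exists_smul_eq_zero_of_not_coeffIdeal_le {f : MvPolynomial (Fin n) T}
    {p : ℕ} (hf : f.IsHomogeneous p) {Q : Ideal (MvPolynomial (Fin n) T)} [hQ : Q.IsPrime]
    (hC : ¬ (coeffIdeal f).map C ≤ Q) (z : topLocalCohomology f) : ∃ s ∉ Q, s • z = 0 := by
  obtain ⟨ξ, hξ⟩ := exists_ext_inversePolynomial T n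
  obtain ⟨t, y, rfl⟩ := exists_ofExt_eq _ _ _ z
  obtain ⟨s, hts, w, hw⟩ := exists_ext_comp_quotientSpanMk_eq f y
  obtain ⟨φ, rfl⟩ := (hξ s).2 w
  -- The class is now given by an inverse polynomial, the value of `φ` at 1; `r` pushes it into the
  -- multiples of `f`, which die in `R ⧸ f R`.
  obtain ⟨r, hr, v, hv⟩ := exists_smul_mem_smul hf hC (φ (Ideal.Quotient.mk _ 1))
  obtain ⟨k, hsk, ψ, hψ⟩ := exists_hom_apply_one (s := s) v
  refine ⟨r, hr, ?_⟩
  have hφψ : r • (powProj hsk ≫ φ) = f • ψ := hom_ext_one (by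
    refine hv.trans ?_
    rw [← hψ]
    rfl)
  rw [← ofExt_comp_powProj _ _ _ hts, ← hw, ← ofExt_comp_powProj _ _ _ hsk, ← map_smul]
  have : r • (Ext.mk₀ (powProj hsk)).comp (((Ext.mk₀ φ).comp ξ (zero_add n)).comp
      (Ext.mk₀ (quotientSpanMk f)) (add_zero n)) (zero_add n) = 0 := by
    rw [← Ext.comp_assoc_of_third_deg_zero, Ext.mk₀_comp_mk₀_assoc, ← Ext.smul_comp,
      ← Ext.smul_comp, ← Ext.mk₀_smul, hφψ, Ext.mk₀_smul, Ext.smul_comp, Ext.smul_comp,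
      ← Ext.comp_smul, ← Ext.mk₀_smul, smul_quotientSpanMk, Ext.mk₀_zero, Ext.comp_zero]
  exact (congr_arg _ this).trans (map_zero _)

/-- The witness is the class of $(x_1\cdots x_n)^{-1}$. If `s` kills it, then at a later stage `s`
times this monomial is a multiple of `f` among inverse polynomials. -/
lemma topLocalCohomology_exists_mem_of_smul_eq_zero (f : MvPolynomial (Fin n) T) :
    ∃ z : topLocalCohomology f, ∀ s : MvPolynomial (Fin n) T, s • z = 0 →
      constantCoeff s ∈ coeffIdeal f := by
  obtain ⟨ξ, hξ⟩ := exists_ext_inversePolynomial T n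
  obtain ⟨t, -, φ, hφ⟩ := exists_hom_apply_one (s := 0) (inverseMonomial T (0 : Fin n →₀ ℕ))
  refine ⟨ofExt _ _ n t (((Ext.mk₀ φ).comp ξ (zero_add n)).comp
      (Ext.mk₀ (quotientSpanMk f)) (add_zero n)), fun s hs => ?_⟩
  rw [← map_smul] at hs
  obtain ⟨k, htk, hk⟩ := exists_comp_powProj_eq_zero _ _ _ _ hs
  rw [Ext.comp_smul, ← Ext.comp_assoc_of_third_deg_zero, Ext.mk₀_comp_mk₀_assoc, ← Ext.smul_comp,
      ← Ext.smul_comp, ← Ext.mk₀_smul] at hk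
  obtain ⟨l, hkl, w, hw⟩ := exists_powProj_comp_eq_smul f _ hk
  obtain ⟨ψ, rfl⟩ := (hξ l).2 w
  rw [Ext.mk₀_comp_mk₀_assoc] at hw
  have h := (hξ l).1 (a₁ := powProj hkl ≫ (s • (powProj htk ≫ φ))) (a₂ := f • ψ) (by
    refine hw.trans ?_
    change _ = (Ext.mk₀ (f • ψ)).comp ξ (zero_add n)
    rw [Ext.mk₀_smul, Ext.smul_comp])
  refine constantCoeff_mem_coeffIdeal (w := ψ (Ideal.Quotient.mk _ 1)) ?_
  rw [← hφ]
  exact congr_arg (fun χ => χ (Ideal.Quotient.mk _ 1)) h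

theorem mem_support_topLocalCohomology_iff {f : MvPolynomial (Fin n) T} {p : ℕ}
    (hf : f.IsHomogeneous p) (Q : PrimeSpectrum (MvPolynomial (Fin n) T)) :
    Q ∈ Module.support (MvPolynomial (Fin n) T) (topLocalCohomology f) ↔
      idealOfVars (Fin n) T ⊔ (coeffIdeal f).map C ≤ Q.asIdeal := by
  rw [Module.mem_support_iff', sup_le_iff]
  constructor
  · rintro ⟨z, hz⟩
    constructor <;> by_contra h
    · obtain ⟨s, hs, h0⟩ := topLocalCohomology_exists_smul_eq_zero_of_not_idealOfVars_le f h z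
      exact hz s hs h0
    · obtain ⟨s, hs, h0⟩ := topLocalCohomology_exists_smul_eq_zero_of_not_coeffIdeal_le hf h z
      exact hz s hs h0
  · rintro ⟨hI, hC⟩
    obtain ⟨z, hz⟩ := topLocalCohomology_exists_mem_of_smul_eq_zero f
    exact ⟨z, fun s hs h0 => hs
      (mem_of_constantCoeff_mem hI (hC (Ideal.mem_map_of_mem C (hz s h0))))⟩

lemma homogeneousMaximalIdeal_eq_comap [IsLocalRing T] :
    homogeneousMaximalIdeal T n = (IsLocalRing.maximalIdeal T).comap constantCoeff := by
  apply le_antisymm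
  · refine sup_le (Ideal.map_le_iff_le_comap.2 fun r hr => ?_) (Ideal.span_le.2 ?_)
    · simpa using hr
    · rintro _ ⟨i, rfl⟩
      simp
  · intro s hs
    exact mem_of_constantCoeff_mem le_sup_right
      ((le_sup_left : _ ≤ homogeneousMaximalIdeal T n) (Ideal.mem_map_of_mem C hs))

lemma isMaximal_homogeneousMaximalIdeal [IsLocalRing T] :
    (homogeneousMaximalIdeal T n).IsMaximal := by
  rw [homogeneousMaximalIdeal_eq_comap]
  exact Ideal.comap_isMaximal_of_surjective _ fun r => ⟨C r, constantCoeff_C _ r⟩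

end

theorem mainTheorem2 {T : Type u} [CommRing T] [IsNoetherianRing T] [IsLocalRing T]
    (n p : ℕ) (f : MvPolynomial (Fin n) T) (hf : f.IsHomogeneous p) :
    Module.support (MvPolynomial (Fin n) T) (topLocalCohomology f) =
        {Q : PrimeSpectrum (MvPolynomial (Fin n) T) |
          MvPolynomial.idealOfVars (Fin n) T ⊔ (coeffIdeal f).map MvPolynomial.C ≤ Q.asIdeal} ∧
      (IsPrimaryTo (coeffIdeal f) (IsLocalRing.maximalIdeal T) →
        ∃ hP : (homogeneousMaximalIdeal T n).IsPrime,
          Module.support (MvPolynomial (Fin n) T) (topLocalCohomology f) =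
            {⟨homogeneousMaximalIdeal T n, hP⟩}) := by
  refine ⟨Set.ext fun Q => mem_support_topLocalCohomology_iff hf Q, fun h => ?_⟩
  have hP := isMaximal_homogeneousMaximalIdeal (T := T) (n := n)
  refine ⟨hP.isPrime, Set.ext fun Q => ?_⟩
  rw [mem_support_topLocalCohomology_iff hf, Set.mem_singleton_iff, PrimeSpectrum.ext_iff]
  constructor
  · intro hQ
    refine (hP.eq_of_le Q.2.ne_top (sup_le (Ideal.map_le_iff_le_comap.2 ?_)
      (le_sup_left.trans hQ))).symm
    rw [← h.2]
    -- The contraction of `Q` to `T` is prime and contains `coeffIdeal f`, hence its radical, the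
    -- maximal ideal.
    exact (Q.2.comap MvPolynomial.C).radical_le_iff.2 (Ideal.map_le_iff_le_comap.1 (le_sup_right.trans hQ))
  · intro hQ
    rw [hQ]
    refine sup_le le_sup_right (le_trans (Ideal.map_mono ?_) le_sup_left)
    rw [← h.2]
    exact Ideal.le_radical
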